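/- **Setting.** Let $G=\{(x,y,z): x,y\in\mathbb R,\ z\in\mathbb C,\ |z|=1\}$ be the Heisenberg group with $(x,y,z)(x',y',z')=(x+x',y+y',zz'e^{\pi i(xy'-yx')})$. Put $\pi(x,y,z)=(x,y)$, $s(x,y)=(x,y,1)$ and $e((x,y),(x',y'))=e^{2\pi i(xy'-yx')}$. Let $\rho$ be the representation of $G$ on $\mathcal H=L^2(\mathbb R)$ given by $(\rho(x,y,z)\varphi)(t)=ze^{\pi i(xy+2yt)}\varphi(t+x)$, and for a finite rank (bounded) operator $X$ on $\mathcal H$ let $\alpha(X)(w)=\operatorname{tr}(X\rho(s(w))^*)$, $w\in\mathbb R^2$. Inner products are written linear in the first variable, and $\varphi\otimes\bar\psi$ denotes the operator $\chi\mapsto\langle\chi,\psi\rangle\varphi$. Let $N\subseteq\mathbb R^2$ be a lattice (discrete and of full rank) which is isotropic, i.e. $e(n,n')=1$ for all $n,n'\in N$; let $N^\perp=\{w\in\mathbb R^2: e(n,w)=1\ \forall n\in N\}$; let $M\supseteq N$ be a maximal isotropic subgroup of $\mathbb R^2$ (so $M\subseteq N^\perp$), let $\zeta:\pi^{-1}(M)\to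 U(1)$ be a character with $\zeta(0,0,z)=z$, and let $\Omega\subseteq\mathbb R^2$ be a measurable fundamental domain for the translation action of $N^\perp$. Let $\tau=\operatorname{Ind}_{\pi^{-1}(M)}^{\pi^{-1}(N^\perp)}\zeta$, acting by right translation on the finite-dimensional Hilbert space $\mathcal H_\tau$ of functions $f:\pi^{-1}(N^\perp)\to\mathbb C$ with $f(kg)=\zeta(k)f(g)$ for $k\in\pi^{-1}(M)$, with $\langle f,f'\rangle$ the sum of $f\overline{f'}$ over the cosets $\pi^{-1}(M)\backslash\pi^{-1}(N^\perp)$. Let $\rho_N=\operatorname{Ind}_{\pi^{-1}(N^\perp)}^{G}\tau$, acting by $(\rho_N(g)\varphi)(g')=\varphi(g'g)$ on the Hilbert space $\mathcal H_N$ of (classes modulo a.e. equality of) measurable $\varphi:G\to\mathcal H_\tau$ with $\varphi(hg)=\tau(h)\varphi(g)$ for $h\in\pi^{-1}(N^\perp)$, $g\in G$, and $\|\varphi\|^2=\int_{\Omega}\|\varphi(s(w))\|^2\,dw<\infty$. Let $\mathcal Z:\mathcal H\to\mathcal H_N$ be a unitary operator with $\mathcal Z\rho(g)=\rho_N(g)\mathcal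 Z$ for all $g\in G$, and put $X_N=\mathcal ZX\mathcal Z^{-1}$. For a finite rank operator $Y=\sum_j\varphi_j\otimes\overline{\psi_j}$ on $\mathcal H_N$ (finite sum) let $F_Y:G\to\mathcal B(\mathcal H_\tau)$, $F_Y(g)=\sum_j\varphi_j(g)\otimes\overline{\psi_j(g)}$. For $n\in N^\perp$ let $\Xi_n(g)=e(\pi(g),n)\,\tau(s(n))$. For a measurable $F:G\to\mathcal B(\mathcal H_\tau)$ with $F(hg)=\tau(h)F(g)\tau(h)^{-1}$ ($h\in\pi^{-1}(N^\perp)$) and $\int_\Omega\|F(s(w))\|\,dw<\infty$ (that is, $F\in L^1(G/\!/\pi^{-1}(N^\perp),\mathcal B(\mathcal H_\tau))$), its $n$-th Fourier–Wigner coefficient is $$\alpha(F)(n)=\int_{\Omega}\operatorname{tr}\big(F(s(w))\,\Xi_n(s(w))^*\big)\,dw .$$ **Theorem 2.10.** Let $X$ be a finite rank operator on $\mathcal H$. Then $X_N$ can be written as a finite sum $\sum_j\varphi_j\otimes\overline{\psi_j}$ with $\varphi_j,\psi_j\in\mathcal H_N$, and for every such expression, and every choice of representatives of the $\varphi_j,\psi_j$,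 the function $F_{X_N}$ belongs to $L^1(G/\!/\pi^{-1}(N^\perp),\mathcal B(\mathcal H_\tau))$ and $$\alpha(F_{X_N})(n)=\alpha(X)(n)\qquad\text{for all } n\in N^\perp .$$ -/

import Mathlib

open MeasureTheory
open scoped ComplexConjugate

namespace WeylBenedicks

noncomputable section

/-! ### The Heisenberg group and the pairing `e` -/

/-- The Heisenberg group: triples `(x, y, z)` with `x y : ℝ` and `z` in the unit circle. -/
@[ext] structure Heisenberg where
  x : ℝ
  y : ℝ
  z : Circle

namespace Heisenberg

/-- The projection `(x, y, z) ↦ (x, y)`. -/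
def proj (g : Heisenberg) : ℝ × ℝ := (g.x, g.y)

/-- The section `(x, y) ↦ (x, y, 1)`. -/
def sec (w : ℝ × ℝ) : Heisenberg := ⟨w.1, w.2, 1⟩

instance : Mul Heisenberg :=
  ⟨fun g g' => ⟨g.x + g'.x, g.y + g'.y,
    g.z * g'.z * Circle.exp (Real.pi * (g.x * g'.y - g.y * g'.x))⟩⟩
instance : One Heisenberg := ⟨⟨0, 0, 1⟩⟩
instance : Inv Heisenberg := ⟨fun g => ⟨-g.x, -g.y, g.z⁻¹⟩⟩

@[simp] lemma mul_x (g g' : Heisenberg) : (g * g').x = g.x + g'.x := rfl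
@[simp] lemma mul_y (g g' : Heisenberg) : (g * g').y = g.y + g'.y := rfl
@[simp] lemma mul_z (g g' : Heisenberg) : (g * g').z =
    g.z * g'.z * Circle.exp (Real.pi * (g.x * g'.y - g.y * g'.x)) := rfl
@[simp] lemma one_x : (1 : Heisenberg).x = 0 := rfl
@[simp] lemma one_y : (1 : Heisenberg).y = 0 := rfl
@[simp] lemma one_z : (1 : Heisenberg).z = 1 := rfl
@[simp] lemma inv_x (g : Heisenberg) : (g⁻¹).x = -g.x := rfl
@[simp] lemma inv_y (g : Heisenberg) : (g⁻¹).y = -g.y := rfl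
@[simp] lemma inv_z (g : Heisenberg) : (g⁻¹).z = g.z⁻¹ := rfl

instance : Group Heisenberg :=
  Group.ofLeftAxioms
    (by
      intro a b c
      ext1
      · simp [add_assoc]
      · simp [add_assoc]
      · simp only [mul_x, mul_y, mul_z]
        have h : Circle.exp (Real.pi * (a.x * b.y - a.y * b.x)) *
            Circle.exp (Real.pi * ((a.x + b.x) * c.y - (a.y + b.y) * c.x)) =
            Circle.exp (Real.pi * (b.x * c.y - b.y * c.x)) *
            Circle.exp (Real.pi * (a.x * (b.y + c.y) - a.y * (b.x + c.x))) := by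
          rw [← Circle.exp_add, ← Circle.exp_add]; congr 1; ring
        rw [mul_right_comm (a.z * b.z), mul_assoc _ (Circle.exp _) (Circle.exp _), h]
        simp only [mul_assoc])
    (by intro a; ext1 <;> simp)
    (by
      intro a
      ext1
      · simp
      · simp
      · simp only [mul_z, inv_x, inv_y, inv_z, inv_mul_cancel, one_mul, one_z]
        rw [show Real.pi * (-a.x * a.y - -a.y * a.x) = 0 by ring, Circle.exp_zero])

@[simp] lemma proj_mul (g g' : Heisenberg) : (g * g').proj = g.proj + g'.proj := rfl
@[simp] lemma proj_one : (1 : Heisenberg).proj = 0 := rfl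
@[simp] lemma proj_inv (g : Heisenberg) : (g⁻¹).proj = -g.proj := rfl
@[simp] lemma proj_sec (w : ℝ × ℝ) : (sec w).proj = w := rfl

/-- The preimage under the projection of a subgroup of the plane. -/
def preim (K : AddSubgroup (ℝ × ℝ)) : Subgroup Heisenberg where
  carrier := {g | g.proj ∈ K}
  mul_mem' := fun ha hb => K.add_mem ha hb
  one_mem' := K.zero_mem
  inv_mem' := fun ha => K.neg_mem ha

lemma mem_preim {K : AddSubgroup (ℝ × ℝ)} {g : Heisenberg} : g ∈ preim K ↔ g.proj ∈ K := Iff.rfl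

end Heisenberg

open Heisenberg

/-- The pairing `e((x, y), (x', y')) = exp (2 π i (x y' - y x'))`. -/
def pairing (w w' : ℝ × ℝ) : Circle := Circle.exp (2 * Real.pi * (w.1 * w'.2 - w.2 * w'.1))

lemma pairing_add_right (u v w : ℝ × ℝ) : pairing u (v + w) = pairing u v * pairing u w := by
  simp only [pairing, ← Circle.exp_add, Prod.fst_add, Prod.snd_add]; congr 1; ring

lemma pairing_neg_right (u v : ℝ × ℝ) : pairing u (-v) = (pairing u v)⁻¹ := by
  simp only [pairing, ← Circle.exp_neg, Prod.fst_neg, Prod.snd_neg]; congr 1; ring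

lemma pairing_zero_right (u : ℝ × ℝ) : pairing u 0 = 1 := by simp [pairing]

/-- A subset of the plane is isotropic if the pairing is trivial on it. -/
def Isotropic (K : Set (ℝ × ℝ)) : Prop := ∀ u ∈ K, ∀ v ∈ K, pairing u v = 1

/-! ### The standard realization on `L²(ℝ)` and the Fourier-Wigner transform -/

/-- The Hilbert space `L²(ℝ)`. -/
abbrev L2R : Type := Lp ℂ 2 (volume : Measure ℝ)

/-- The function `t ↦ z exp (π i (x y + 2 y t)) φ(t + x)`. -/
def schrodingerFun (g : Heisenberg) (φ : ℝ → ℂ) (t : ℝ) : ℂ :=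
  (g.z : ℂ) * (Circle.exp (Real.pi * (g.x * g.y + 2 * g.y * t)) : ℂ) * φ (t + g.x)

lemma schrodingerFun_memLp (g : Heisenberg) {φ : ℝ → ℂ} (hφ : MemLp φ 2 volume) :
    MemLp (schrodingerFun g φ) 2 volume := by
  have h1 : MemLp (fun t => φ (t + g.x)) 2 volume :=
    hφ.comp_measurePreserving (measurePreserving_add_right volume g.x)
  refine h1.of_le ?_ (Filter.Eventually.of_forall fun t => ?_)
  · refine AEStronglyMeasurable.mul (Continuous.aestronglyMeasurable ?_) h1.1
    fun_prop
  · simp only [schrodingerFun, norm_mul, Circle.norm_coe, one_mul, le_refl]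

lemma schrodingerFun_congr (g : Heisenberg) {φ ψ : ℝ → ℂ} (h : φ =ᵐ[volume] ψ) :
    schrodingerFun g φ =ᵐ[volume] schrodingerFun g ψ := by
  have := (measurePreserving_add_right volume g.x).quasiMeasurePreserving.ae_eq_comp h
  filter_upwards [this] with t ht
  simp only [Function.comp_apply] at ht
  simp [schrodingerFun, ht]

/-- The Schrödinger representation of the Heisenberg group on `L²(ℝ)`:
`(ρ(x, y, z) φ)(t) = z exp (π i (x y + 2 y t)) φ(t + x)`. -/
def schrodinger (g : Heisenberg) : L2R →ₗᵢ[ℂ] L2R where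
  toFun φ := (schrodingerFun_memLp g (Lp.memLp φ)).toLp _
  map_add' φ ψ := by
    rw [← MemLp.toLp_add]
    apply MemLp.toLp_congr
    refine (schrodingerFun_congr g (Lp.coeFn_add φ ψ)).trans (Filter.Eventually.of_forall ?_)
    intro t; simp [schrodingerFun, mul_add]
  map_smul' c φ := by
    rw [RingHom.id_apply, ← MemLp.toLp_const_smul]
    apply MemLp.toLp_congr
    refine (schrodingerFun_congr g (Lp.coeFn_smul c φ)).trans (Filter.Eventually.of_forall ?_)
    intro t; simp [schrodingerFun]; ring
  norm_map' φ := by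
    change ‖MemLp.toLp (schrodingerFun g φ) (schrodingerFun_memLp g (Lp.memLp φ))‖ = _
    rw [Lp.norm_toLp, Lp.norm_def]
    congr 1
    rw [← eLpNorm_comp_measurePreserving (Lp.aestronglyMeasurable φ)
      (measurePreserving_add_right volume g.x)]
    exact eLpNorm_congr_norm_ae (Filter.Eventually.of_forall fun t => by
      simp only [schrodingerFun, norm_mul, Circle.norm_coe, one_mul, Function.comp_apply])

/-- The trace `∑ i, ⟪b i, T b i⟫` of a trace class operator on a Hilbert space, computed in some
Hilbert basis `b` (for a trace class operator it does not depend on the basis). -/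
def opTrace {H : Type*} [NormedAddCommGroup H] [InnerProductSpace ℂ H] [CompleteSpace H]
    (T : H →L[ℂ] H) : ℂ :=
  let b := (exists_hilbertBasis ℂ H).choose_spec.choose
  ∑' i, inner ℂ (b i) (T (b i))

/-- The modified Fourier-Wigner transform `α(X)(w) = tr (X ρ(s(w))^*)`. -/
def fourierWigner (X : L2R →L[ℂ] L2R) (w : ℝ × ℝ) : ℂ :=
  opTrace (X ∘L ContinuousLinearMap.adjoint (schrodinger (sec w)).toContinuousLinearMap)

/-! ### The double induced realization -/

/-- `N^⊥ = {w | e(n, w) = 1 for all n ∈ N}`. -/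
def perp (N : Set (ℝ × ℝ)) : AddSubgroup (ℝ × ℝ) where
  carrier := {w | ∀ n ∈ N, pairing n w = 1}
  add_mem' := fun ha hb n hn => by rw [pairing_add_right, ha n hn, hb n hn, one_mul]
  zero_mem' := fun n _ => pairing_zero_right n
  neg_mem' := fun ha n hn => by rw [pairing_neg_right, ha n hn, inv_one]

/-- The choices from which the double induced realization is built: an isotropic lattice `N` in the
plane, a maximal isotropic subgroup `M` containing `N`, a character `ζ` of the preimage of `M` in
the Heisenberg group which restricts to the identity on the centre, and a (measurable) fundamental
domain `Ω` for the action of `N^⊥` on the plane by translation. -/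
structure InducingDatum where
  N : Submodule ℤ (ℝ × ℝ)
  discrete : DiscreteTopology N
  lattice : IsZLattice ℝ N
  isotropic : Isotropic (N : Set (ℝ × ℝ))
  M : AddSubgroup (ℝ × ℝ)
  N_subset : ∀ n ∈ N, n ∈ M
  M_isotropic : Isotropic (M : Set (ℝ × ℝ))
  M_maximal : ∀ K : AddSubgroup (ℝ × ℝ), Isotropic (K : Set (ℝ × ℝ)) → M ≤ K → K ≤ M
  ζ : preim M →* Circle
  ζ_central : ∀ h : preim M, h.1.proj = 0 → ζ h = h.1.z
  Ω : Set (ℝ × ℝ)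
  fundamental : IsAddFundamentalDomain (perp (N : Set (ℝ × ℝ))) Ω volume

namespace InducingDatum

variable (D : InducingDatum)

/-- The group `N^⊥`. -/
abbrev Nperp : AddSubgroup (ℝ × ℝ) := perp (D.N : Set (ℝ × ℝ))

lemma M_le_Nperp : D.M ≤ D.Nperp := fun m hm n hn => D.M_isotropic n (D.N_subset n hn) m hm

lemma pairing_eq_one {u v : ℝ × ℝ} (h : pairing u v = 1) :
    ∃ k : ℤ, u.1 * v.2 - u.2 * v.1 = k := by
  rw [pairing, Circle.exp_eq_one] at h
  obtain ⟨k, hk⟩ := h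
  refine ⟨k, ?_⟩
  have := Real.pi_pos
  have h2 : (2 * Real.pi) * (u.1 * v.2 - u.2 * v.1 - k) = 0 := by linarith
  rcases mul_eq_zero.1 h2 with h3 | h3 <;> linarith

/-- Some nonzero multiple carries `N^⊥` into `N`. -/
lemma exists_smul_mem : ∃ a : ℤ, a ≠ 0 ∧ ∀ w ∈ D.Nperp, a • w ∈ D.N := by
  have := D.discrete
  have := D.lattice
  have hr : Module.finrank ℤ D.N = 2 := by
    rw [ZLattice.rank ℝ D.N]; simp
  let b : Module.Basis (Fin 2) ℤ D.N :=
    (Module.finBasis ℤ D.N).reindex (finCongr hr)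
  let B := b.ofZLatticeBasis ℝ D.N
  have hB : ∀ i, B i = (b i : ℝ × ℝ) := fun i => b.ofZLatticeBasis_apply ℝ D.N i
  obtain ⟨a, ha⟩ := pairing_eq_one (D.isotropic (b 0) (b 0).2 (b 1) (b 1).2)
  have key : ∀ w : ℝ × ℝ, w = B.repr w 0 • (b 0 : ℝ × ℝ) + B.repr w 1 • (b 1 : ℝ × ℝ) := by
    intro w
    have := B.sum_repr w
    rw [Fin.sum_univ_two, hB, hB] at this
    exact this.symm
  refine ⟨a, ?_, ?_⟩
  · rintro rfl
    have hli := B.linearIndependent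
    rw [Fintype.linearIndependent_iff] at hli
    have e1 := hli ![((b 1 : ℝ × ℝ)).1, -((b 0 : ℝ × ℝ)).1] (by
      rw [Fin.sum_univ_two, hB, hB]
      ext
      · simp; ring
      · simp at ha ⊢; linarith)
    have e2 := hli ![((b 1 : ℝ × ℝ)).2, -((b 0 : ℝ × ℝ)).2] (by
      rw [Fin.sum_univ_two, hB, hB]
      ext
      · simp at ha ⊢; linarith
      · simp; ring)
    have z1 := e1 0
    have z2 := e2 0
    simp at z1 z2
    have : (b 1 : ℝ × ℝ) = 0 := Prod.ext z1 z2
    exact B.ne_zero 1 (by rw [hB, this])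
  · intro w hw
    obtain ⟨p, hp⟩ := pairing_eq_one (hw (b 0) (b 0).2)
    obtain ⟨q, hq⟩ := pairing_eq_one (hw (b 1) (b 1).2)
    have hk := key w
    set x := B.repr w 0
    set y := B.repr w 1
    have h1 : w.1 = x * (b 0 : ℝ × ℝ).1 + y * (b 1 : ℝ × ℝ).1 := by
      conv_lhs => rw [hk]
      simp
    have h2 : w.2 = x * (b 0 : ℝ × ℝ).2 + y * (b 1 : ℝ × ℝ).2 := by
      conv_lhs => rw [hk]
      simp
    have hya : y * a = p := by rw [← ha, ← hp, h1, h2]; ring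
    have hxa : x * a = -q := by rw [← ha, ← hq, h1, h2]; ring
    have : a • w = ((-q) • b 0 + p • b 1 : D.N) := by
      have hcast : a • w = (a : ℝ) • w := (Int.cast_smul_eq_zsmul ℝ a w).symm
      rw [hcast, hk, smul_add, smul_smul, smul_smul, mul_comm _ x, mul_comm _ y, hya, hxa]
      have h3 : ((-q : ℝ)) • (b 0 : ℝ × ℝ) = (-q) • (b 0 : ℝ × ℝ) := by
        rw [← Int.cast_smul_eq_zsmul ℝ (-q)]; simp
      rw [h3, Int.cast_smul_eq_zsmul]
      simp
    rw [this]
    exact Subtype.property _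

/-- An injective homomorphism from `N^⊥` to `N`. -/
lemma exists_injective : ∃ f : D.Nperp →ₗ[ℤ] D.N, Function.Injective f := by
  obtain ⟨a, ha, h⟩ := D.exists_smul_mem
  refine ⟨⟨⟨fun w => ⟨a • w.1, h w.1 w.2⟩, fun u v => Subtype.ext (smul_add a u.1 v.1)⟩,
    fun c u => Subtype.ext (smul_comm a c u.1)⟩, fun u v huv => ?_⟩
  have : a • u.1 = a • v.1 := congrArg Subtype.val huv
  exact Subtype.ext (smul_right_injective _ ha this)

instance : Countable D.Nperp := by
  have := D.discrete
  obtain ⟨f, hf⟩ := D.exists_injective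
  have := D.lattice
  have : Countable D.N := inferInstance
  exact hf.countable

/-- The quotient `N^⊥ / M`. -/
abbrev Cosets : Type := D.Nperp ⧸ D.M.addSubgroupOf D.Nperp

instance : Finite D.Cosets := by
  have := D.discrete
  obtain ⟨f, hf⟩ := D.exists_injective
  have : Module.Finite ℤ D.Nperp := Module.Finite.of_injective f hf
  have : Module.Finite ℤ D.Cosets :=
    Module.Finite.of_surjective
      (QuotientAddGroup.mk' (D.M.addSubgroupOf D.Nperp)).toIntLinearMap
      (QuotientAddGroup.mk'_surjective _)
  obtain ⟨a, ha, h⟩ := D.exists_smul_mem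
  refine Module.finite_of_fg_torsion D.Cosets ?_
  intro q
  obtain ⟨w, rfl⟩ := QuotientAddGroup.mk_surjective q
  refine ⟨⟨a, mem_nonZeroDivisors_of_ne_zero ha⟩, ?_⟩
  change a • (QuotientAddGroup.mk w : D.Cosets) = 0
  rw [← QuotientAddGroup.mk_zsmul, QuotientAddGroup.eq_zero_iff]
  exact D.N_subset _ (h w.1 w.2)

instance : Fintype D.Cosets := Fintype.ofFinite _

/-! #### The representation `τ` induced by `ζ` -/

/-- The space of `τ = Ind ζ`: functions `f` on the preimage of `N^⊥` with `f(k g) = ζ(k) f(g)` for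
`k` in the preimage of `M`. -/
def tauSubmodule : Submodule ℂ (preim D.Nperp → ℂ) where
  carrier := {f | ∀ (k : preim D.M) (g : preim D.Nperp),
    f (⟨k.1, D.M_le_Nperp k.2⟩ * g) = (D.ζ k : ℂ) * f g}
  add_mem' := fun ha hb k g => by
    simp only [Pi.add_apply, ha k g, hb k g, mul_add]
  zero_mem' := fun k g => by simp
  smul_mem' := fun c f hf k g => by
    simp only [Pi.smul_apply, hf k g, smul_eq_mul]; ring

/-- The Hilbert space `H_τ`. -/
def Htau : Type := D.tauSubmodule

instance : AddCommGroup D.Htau := inferInstanceAs (AddCommGroup D.tauSubmodule)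
instance : Module ℂ D.Htau := inferInstanceAs (Module ℂ D.tauSubmodule)

instance : FunLike D.Htau (preim D.Nperp) ℂ :=
  ⟨fun f => Subtype.val (p := (· ∈ D.tauSubmodule)) f, Subtype.val_injective⟩

lemma Htau_mul (f : D.Htau) (k : preim D.M) (g : preim D.Nperp) :
    f (⟨k.1, D.M_le_Nperp k.2⟩ * g) = (D.ζ k : ℂ) * f g := f.2 k g

/-- A representative in the preimage of `N^⊥` of a coset of `M` in `N^⊥`. -/
def rep (q : D.Cosets) : preim D.Nperp := ⟨sec q.out.1, q.out.2⟩

/-- The coset of an element of the preimage of `N^⊥`. -/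
def coset (g : preim D.Nperp) : D.Cosets := QuotientAddGroup.mk ⟨g.1.proj, g.2⟩

lemma exists_eq_mul_rep (g : preim D.Nperp) :
    ∃ k : preim D.M, g = ⟨k.1, D.M_le_Nperp k.2⟩ * D.rep (D.coset g) := by
  refine ⟨⟨g.1 * (D.rep (D.coset g)).1⁻¹, ?_⟩, ?_⟩
  · rw [mem_preim, proj_mul, proj_inv]
    have h : (QuotientAddGroup.mk (D.coset g).out : D.Cosets) = D.coset g :=
      Quotient.out_eq _
    have h2 := QuotientAddGroup.eq.1 h
    rw [AddSubgroup.mem_addSubgroupOf] at h2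
    have h3 : g.1.proj + -(D.rep (D.coset g)).1.proj =
        -((D.coset g).out : D.Nperp).1 + g.1.proj := by
      rw [add_comm]; rfl
    rw [h3]; exact h2
  · ext1; simp

lemma Htau_ext {f f' : D.Htau} (h : ∀ q, f (D.rep q) = f' (D.rep q)) : f = f' := by
  refine Subtype.ext (funext fun g => ?_)
  obtain ⟨k, hk⟩ := D.exists_eq_mul_rep g
  have e1 : f g = (D.ζ k : ℂ) * f (D.rep (D.coset g)) := by
    conv_lhs => rw [hk]
    exact D.Htau_mul f k _
  have e2 : f' g = (D.ζ k : ℂ) * f' (D.rep (D.coset g)) := by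
    conv_lhs => rw [hk]
    exact D.Htau_mul f' k _
  exact e1.trans ((congrArg _ (h _)).trans e2.symm)

/-- The inner product of `H_τ`, the sum over the cosets of `M` in `N^⊥` of `conj (f g) * f' g`,
a quantity that depends only on the coset of `g`. -/
@[reducible] def tauCore : InnerProductSpace.Core ℂ D.Htau where
  inner f f' := ∑ q : D.Cosets, conj (f (D.rep q)) * f' (D.rep q)
  conj_inner_symm f f' := by simp [mul_comm]
  re_inner_nonneg f := by
    rw [map_sum]
    refine Finset.sum_nonneg fun q _ => ?_
    rw [← Complex.normSq_eq_conj_mul_self]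
    simpa using Complex.normSq_nonneg _
  add_left f f' f'' := by
    rw [← Finset.sum_add_distrib]
    refine Finset.sum_congr rfl fun q _ => ?_
    change conj (f (D.rep q) + f' (D.rep q)) * _ = _
    rw [map_add, add_mul]
  smul_left f f' c := by
    rw [Finset.mul_sum]
    refine Finset.sum_congr rfl fun q _ => ?_
    change conj (c * f (D.rep q)) * _ = _
    rw [map_mul, mul_assoc]
  definite f hf := by
    refine D.Htau_ext fun q => ?_
    change f (D.rep q) = 0
    have hf' : ((∑ q : D.Cosets, Complex.normSq (f (D.rep q)) : ℝ) : ℂ) = 0 := by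
      rw [← hf]; push_cast
      exact Finset.sum_congr rfl fun q _ => Complex.normSq_eq_conj_mul_self
    have h2 := (Finset.sum_eq_zero_iff_of_nonneg
      (fun q _ => Complex.normSq_nonneg (f (D.rep q)))).1 (Complex.ofReal_eq_zero.1 hf') q
      (Finset.mem_univ q)
    exact Complex.normSq_eq_zero.1 h2

instance : NormedAddCommGroup D.Htau := D.tauCore.toNormedAddCommGroup
instance : InnerProductSpace ℂ D.Htau := InnerProductSpace.ofCore D.tauCore.toCore

lemma Htau_inner (f f' : D.Htau) :
    inner ℂ f f' = ∑ q : D.Cosets, conj (f (D.rep q)) * f' (D.rep q) := rfl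

instance : FiniteDimensional ℂ D.Htau := by
  let ev : D.Htau →ₗ[ℂ] (D.Cosets → ℂ) :=
    { toFun := fun f q => f (D.rep q)
      map_add' := fun _ _ => rfl
      map_smul' := fun _ _ => rfl }
  exact FiniteDimensional.of_injective ev fun f f' h => D.Htau_ext fun q => congrFun h q

instance : CompleteSpace D.Htau := FiniteDimensional.complete ℂ D.Htau

/-- The representation `τ` of the preimage of `N^⊥` on `H_τ`, by right translation:
`(τ(h) f)(g) = f(g h)`. -/
def tau : preim D.Nperp →* (D.Htau →L[ℂ] D.Htau) where
  toFun h := LinearMap.toContinuousLinearMap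
    { toFun := fun f => ⟨fun g => f (g * h), fun k g =>
        (congrArg f (mul_assoc _ g h)).trans (D.Htau_mul f k (g * h))⟩
      map_add' := fun _ _ => rfl
      map_smul' := fun _ _ => rfl }
  map_one' := by
    ext f; refine Subtype.ext (funext fun g => ?_); change f (g * 1) = f g; rw [mul_one]
  map_mul' h h' := by
    ext f; refine Subtype.ext (funext fun g => ?_)
    change f (g * (h * h')) = f (g * h * h'); rw [mul_assoc]

lemma tau_apply (h : preim D.Nperp) (f : D.Htau) (g : preim D.Nperp) :
    D.tau h f g = f (g * h) := rfl

/-- `τ` is unitary. -/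
lemma inner_tau (h : preim D.Nperp) (f f' : D.Htau) :
    inner ℂ (D.tau h f) (D.tau h f') = inner ℂ f f' := by
  simp only [Htau_inner, tau_apply]
  have key : ∀ g : preim D.Nperp, conj (f g) * f' g =
      conj (f (D.rep (D.coset g))) * f' (D.rep (D.coset g)) := by
    intro g
    obtain ⟨k, hk⟩ := D.exists_eq_mul_rep g
    have e1 : f g = (D.ζ k : ℂ) * f (D.rep (D.coset g)) := by
      conv_lhs => rw [hk]
      exact D.Htau_mul f k _
    have e2 : f' g = (D.ζ k : ℂ) * f' (D.rep (D.coset g)) := by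
      conv_lhs => rw [hk]
      exact D.Htau_mul f' k _
    have h1 : conj (D.ζ k : ℂ) * (D.ζ k : ℂ) = 1 := by
      rw [← Complex.normSq_eq_conj_mul_self]; simp
    rw [e1, e2, map_mul]
    linear_combination (conj (f (D.rep (D.coset g))) * f' (D.rep (D.coset g))) * h1
  have hc : ∀ q, D.coset (D.rep q * h) = q + D.coset h := by
    intro q
    have h2 : (QuotientAddGroup.mk q.out : D.Cosets) = q := Quotient.out_eq _
    conv_rhs => rw [← h2]
    rfl
  rw [← Equiv.sum_comp (Equiv.addRight (D.coset h))
    (fun q => conj (f (D.rep q)) * f' (D.rep q))]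
  refine Finset.sum_congr rfl fun q _ => ?_
  rw [key, hc]; rfl

lemma norm_tau (h : preim D.Nperp) (f : D.Htau) : ‖D.tau h f‖ = ‖f‖ := by
  rw [@norm_eq_sqrt_re_inner ℂ, @norm_eq_sqrt_re_inner ℂ, inner_tau]

/-! #### The representation `ρ_N` induced by `τ` -/

/-- Functions `φ : G → H_τ`, measurable, with `φ(h g) = τ(h) φ(g)` for `h` in the preimage of `N^⊥`
and `∫_Ω ‖φ(s(w))‖² dw < ∞`. As `φ(x, y, z) = z φ(s(x, y))`, measurability and null sets on the
group are expressed through the section `s`. The covariance is required everywhere: a function which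
satisfies it almost everywhere agrees almost everywhere with one that satisfies it everywhere, and
only for such a representative do the values on the null set `s(Ω)` have a meaning. -/
def preSubmodule : Submodule ℂ (Heisenberg → D.Htau) where
  carrier := {φ | AEStronglyMeasurable (fun w => φ (sec w)) volume ∧
    (∀ (h : preim D.Nperp) (g : Heisenberg), φ (h.1 * g) = D.tau h (φ g)) ∧
    MemLp (fun w => φ (sec w)) 2 (volume.restrict D.Ω)}
  add_mem' := fun {a b} ha hb => ⟨ha.1.add hb.1, fun h g => by
    simp only [Pi.add_apply, ha.2.1 h g, hb.2.1 h g, map_add], ha.2.2.add hb.2.2⟩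
  zero_mem' := ⟨aestronglyMeasurable_zero, fun h g => by simp, MemLp.zero⟩
  smul_mem' := fun c {a} ha => ⟨ha.1.const_smul c, fun h g => by
    simp only [Pi.smul_apply, ha.2.1 h g, map_smul], ha.2.2.const_smul c⟩

/-- The space of functions before identification of functions that agree almost everywhere. -/
def PreHN : Type := D.preSubmodule

instance : AddCommGroup D.PreHN := inferInstanceAs (AddCommGroup D.preSubmodule)
instance : Module ℂ D.PreHN := inferInstanceAs (Module ℂ D.preSubmodule)

instance : FunLike D.PreHN Heisenberg D.Htau :=
  ⟨fun φ => Subtype.val (p := (· ∈ D.preSubmodule)) φ, Subtype.val_injective⟩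

lemma PreHN_mul (φ : D.PreHN) (h : preim D.Nperp) (g : Heisenberg) :
    φ (h.1 * g) = D.tau h (φ g) := φ.2.2.1 h g

lemma PreHN_aesm (φ : D.PreHN) : AEStronglyMeasurable (fun w => φ (sec w)) volume := φ.2.1

lemma PreHN_memLp (φ : D.PreHN) :
    MemLp (fun w => φ (sec w)) 2 (volume.restrict D.Ω) := φ.2.2.2

lemma integrable_inner (φ ψ : D.PreHN) :
    Integrable (fun w => inner ℂ (φ (sec w)) (ψ (sec w))) (volume.restrict D.Ω) := by
  have h := (D.PreHN_memLp φ).norm.integrable_mul (D.PreHN_memLp ψ).norm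
  refine h.mono ((D.PreHN_memLp φ).1.inner (D.PreHN_memLp ψ).1) (Filter.Eventually.of_forall fun w => ?_)
  refine (norm_inner_le_norm _ _).trans (le_of_eq ?_)
  simp

/-- The inner product `∫_Ω ⟪φ(s(w)), ψ(s(w))⟫ dw`. -/
@[reducible] def preCore : PreInnerProductSpace.Core ℂ D.PreHN where
  inner φ ψ := ∫ w in D.Ω, inner ℂ (φ (sec w)) (ψ (sec w))
  conj_inner_symm φ ψ := by
    rw [← integral_conj]; simp
  re_inner_nonneg φ := by
    have : RCLike.re (∫ w in D.Ω, inner ℂ (φ (sec w)) (φ (sec w))) =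
        ∫ w in D.Ω, RCLike.re (inner ℂ (φ (sec w)) (φ (sec w))) :=
      (integral_re (D.integrable_inner φ φ)).symm
    rw [this]
    exact integral_nonneg fun w => inner_self_nonneg
  add_left φ φ' ψ := by
    rw [← integral_add (D.integrable_inner φ ψ) (D.integrable_inner φ' ψ)]
    refine integral_congr_ae (Filter.Eventually.of_forall fun w => ?_)
    exact inner_add_left _ _ _
  smul_left φ ψ c := by
    rw [← integral_const_mul]
    refine integral_congr_ae (Filter.Eventually.of_forall fun w => ?_)
    exact inner_smul_left _ _ _

instance : SeminormedAddCommGroup D.PreHN :=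
  @InnerProductSpace.Core.toSeminormedAddCommGroup ℂ _ _ _ _ D.preCore
instance : InnerProductSpace ℂ D.PreHN := InnerProductSpace.ofCore D.preCore

lemma PreHN_inner (φ ψ : D.PreHN) :
    inner ℂ φ ψ = ∫ w in D.Ω, inner ℂ (φ (sec w)) (ψ (sec w)) := rfl

/-- The Hilbert space `H_N`: functions at distance zero, that is equal almost everywhere, are
identified. -/
abbrev HN : Type := SeparationQuotient D.PreHN

/-- The class of a function in `H_N`. -/
def cls (φ : D.PreHN) : D.HN := SeparationQuotient.mk φ

lemma norm_apply_over (φ : D.PreHN) {g g' : Heisenberg} (hg : g.proj - g'.proj ∈ D.Nperp) :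
    ‖φ g‖ = ‖φ g'‖ := by
  have hm : g * g'⁻¹ ∈ preim D.Nperp := by
    rw [mem_preim, proj_mul, proj_inv, ← sub_eq_add_neg]; exact hg
  have h := D.PreHN_mul φ ⟨g * g'⁻¹, hm⟩ g'
  simp only [inv_mul_cancel_right] at h
  rw [h, norm_tau]

lemma eq_central_mul (w : ℝ × ℝ) (g : Heisenberg) :
    sec w * g = ⟨0, 0, g.z * Circle.exp (Real.pi * (w.1 * g.y - w.2 * g.x))⟩ *
      sec (w + g.proj) := by
  ext1 <;> simp [sec, proj]

/-- The centre acts by scalars. -/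
lemma apply_central_mul (φ : D.PreHN) (z : Circle) (g : Heisenberg) :
    φ ((⟨0, 0, z⟩ : Heisenberg) * g) = (z : ℂ) • φ g := by
  have hz : (⟨0, 0, z⟩ : Heisenberg).proj = 0 := rfl
  have hm : (⟨0, 0, z⟩ : Heisenberg) ∈ preim D.M := by
    rw [mem_preim, hz]; exact D.M.zero_mem
  rw [D.PreHN_mul φ ⟨⟨0, 0, z⟩, D.M_le_Nperp hm⟩ g]
  refine DFunLike.ext _ _ fun k => ?_
  rw [tau_apply]
  have hcomm : k * (⟨⟨0, 0, z⟩, D.M_le_Nperp hm⟩ : preim D.Nperp) =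
      ⟨⟨0, 0, z⟩, D.M_le_Nperp hm⟩ * k := by
    ext1
    ext1 <;> simp [mul_comm]
  rw [hcomm, D.Htau_mul (φ g) ⟨⟨0, 0, z⟩, hm⟩ k, D.ζ_central ⟨⟨0, 0, z⟩, hm⟩ hz]
  rfl

lemma norm_sec_mul (φ : D.PreHN) (w : ℝ × ℝ) (g : Heisenberg) :
    ‖φ (sec w * g)‖ = ‖φ (sec (g.proj + w))‖ :=
  D.norm_apply_over φ (by simp [add_comm w])

open scoped Pointwise in
lemma isAddFundamentalDomain_preimage (v : ℝ × ℝ) :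
    IsAddFundamentalDomain D.Nperp ((v + ·) ⁻¹' D.Ω) volume := by
  have h := D.fundamental.vadd_of_comm (-v)
  have e : (-v) +ᵥ D.Ω = (v + ·) ⁻¹' D.Ω := by
    ext w
    rw [Set.mem_vadd_set_iff_neg_vadd_mem]
    simp
  rwa [e] at h

lemma translate_integral (φ : D.PreHN) (g : Heisenberg) :
    IntegrableOn (fun w => ‖φ (sec w * g)‖ ^ 2) D.Ω volume ∧
    ∫ w in D.Ω, ‖φ (sec w * g)‖ ^ 2 = ∫ w in D.Ω, ‖φ (sec w)‖ ^ 2 := by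
  simp only [norm_sec_mul]
  set u : ℝ × ℝ → ℝ := fun w => ‖φ (sec w)‖ ^ 2 with hu
  have hinv : ∀ (n : D.Nperp) (w : ℝ × ℝ), u (g.proj + (n +ᵥ w)) = u (g.proj + w) := by
    intro n w
    simp only [hu]
    congr 1
    apply D.norm_apply_over φ
    have : (sec (g.proj + (n +ᵥ w))).proj - (sec (g.proj + w)).proj = n.1 := by
      simp only [proj_sec]
      change g.proj + (n.1 + w) - (g.proj + w) = n.1
      abel
    rw [this]; exact n.2
  have hmp : MeasurePreserving (fun w : ℝ × ℝ => g.proj + w) volume volume :=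
    measurePreserving_add_left volume g.proj
  have hemb : MeasurableEmbedding (fun w : ℝ × ℝ => g.proj + w) :=
    measurableEmbedding_addLeft g.proj
  have hfd := D.isAddFundamentalDomain_preimage g.proj
  have hint : IntegrableOn u D.Ω volume :=
    (memLp_two_iff_integrable_sq_norm (D.PreHN_memLp φ).1).1 (D.PreHN_memLp φ)
  constructor
  · rw [D.fundamental.integrableOn_iff (f := fun w => u (g.proj + w)) hfd hinv]
    exact (hmp.integrableOn_comp_preimage hemb (f := u)).2 hint
  · rw [D.fundamental.setIntegral_eq (f := fun w => u (g.proj + w)) hfd hinv]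
    exact hmp.setIntegral_preimage_emb hemb u D.Ω

/-- Right translation: `(g' ↦ φ(g' g))`. -/
def translate (g : Heisenberg) (φ : D.PreHN) : D.PreHN :=
  ⟨fun g' => φ (g' * g), by
    have hm : AEStronglyMeasurable (fun w => φ (sec w * g)) volume := by
      have e : (fun w => φ (sec w * g)) = fun w : ℝ × ℝ =>
          ((g.z * Circle.exp (Real.pi * (w.1 * g.y - w.2 * g.x)) : Circle) : ℂ) •
            φ (sec (w + g.proj)) := by
        funext w
        rw [eq_central_mul, apply_central_mul]
      rw [e]
      have hc : Continuous fun w : ℝ × ℝ =>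
          ((g.z * Circle.exp (Real.pi * (w.1 * g.y - w.2 * g.x)) : Circle) : ℂ) :=
        continuous_subtype_val.comp (continuous_const.mul (Circle.exp.continuous.comp
          (by fun_prop)))
      refine hc.aestronglyMeasurable.smul ?_
      exact (D.PreHN_aesm φ).comp_quasiMeasurePreserving
        (measurePreserving_add_right volume g.proj).quasiMeasurePreserving
    refine ⟨hm, fun h g' => (congrArg φ (mul_assoc h.1 g' g)).trans (D.PreHN_mul φ h (g' * g)), ?_⟩
    exact (memLp_two_iff_integrable_sq_norm hm.restrict).2 (D.translate_integral φ g).1⟩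

lemma translate_apply (g g' : Heisenberg) (φ : D.PreHN) :
    D.translate g φ g' = φ (g' * g) := rfl

lemma PreHN_norm_sq (φ : D.PreHN) : ‖φ‖ ^ 2 = ∫ w in D.Ω, ‖φ (sec w)‖ ^ 2 := by
  rw [@norm_sq_eq_re_inner ℂ, PreHN_inner]
  have : RCLike.re (∫ w in D.Ω, inner ℂ (φ (sec w)) (φ (sec w))) =
      ∫ w in D.Ω, RCLike.re (inner ℂ (φ (sec w)) (φ (sec w))) :=
    (integral_re (D.integrable_inner φ φ)).symm
  rw [this]
  simp only [← norm_sq_eq_re_inner]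

/-- Right translation as an isometry. -/
def translateₗᵢ (g : Heisenberg) : D.PreHN →ₗᵢ[ℂ] D.PreHN where
  toFun := D.translate g
  map_add' _ _ := rfl
  map_smul' _ _ := rfl
  norm_map' φ := by
    change ‖D.translate g φ‖ = ‖φ‖
    rw [← sq_eq_sq₀ (norm_nonneg _) (norm_nonneg _), PreHN_norm_sq, PreHN_norm_sq]
    exact (D.translate_integral φ g).2

/-- The representation `ρ_N = Ind τ` on `H_N`, by right translation:
`(ρ_N(g) φ)(g') = φ(g' g)`. -/
def rhoN (g : Heisenberg) : D.HN →L[ℂ] D.HN :=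
  SeparationQuotient.liftCLM
    (SeparationQuotient.mkCLM ℂ D.PreHN ∘L (D.translateₗᵢ g).toContinuousLinearMap)
    fun _ _ h => SeparationQuotient.mk_eq_mk.2 (h.map (D.translateₗᵢ g).continuous)

lemma rhoN_cls (g : Heisenberg) (φ : D.PreHN) :
    D.rhoN g (D.cls φ) = D.cls (D.translate g φ) := rfl

/-- A unitary intertwiner between the standard realization and `ρ_N`. -/
def Intertwines (Z : L2R ≃ₗᵢ[ℂ] D.HN) : Prop :=
  ∀ (g : Heisenberg) (f : L2R), Z (schrodinger g f) = D.rhoN g (Z f)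

/-- The operator `X_N = Z X Z⁻¹` on `H_N`. -/
def transfer (Z : L2R ≃ₗᵢ[ℂ] D.HN) (X : L2R →L[ℂ] L2R) : D.HN →L[ℂ] D.HN :=
  Z.toLinearIsometry.toContinuousLinearMap ∘L X ∘L Z.symm.toLinearIsometry.toContinuousLinearMap

/-! #### Operator valued functions and their Fourier-Wigner coefficients -/

/-- `Ξ_n(g) = e(π(g), n) τ(s(n))`. -/
def Xi (n : D.Nperp) (g : Heisenberg) : D.Htau →L[ℂ] D.Htau :=
  (pairing g.proj n.1 : ℂ) • D.tau ⟨sec n.1, n.2⟩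

/-- Membership in `L¹(G//π⁻¹(N^⊥), B(H_τ))`: measurable functions with
`F(h g) = τ(h) F(g) τ(h)⁻¹` that are integrable over `Ω`. Here `H_τ` is finite dimensional, so
integrability does not depend on the norm chosen on `B(H_τ)`. -/
structure MemL1 (F : Heisenberg → (D.Htau →L[ℂ] D.Htau)) : Prop where
  measurable : AEStronglyMeasurable (fun w => F (sec w)) volume
  covariant : ∀ (h : preim D.Nperp) (g : Heisenberg), F (h.1 * g) = D.tau h ∘L F g ∘L D.tau h⁻¹
  integrable : IntegrableOn (fun w => F (sec w)) D.Ω volume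

/-- The `n`-th Fourier-Wigner coefficient
`α(F)(n) = ∫_Ω ⟨F(s(w)), Ξ_n(s(w))⟩ dw`, where `⟨A, B⟩ = tr (A B^*)`. -/
def coeff (F : Heisenberg → (D.Htau →L[ℂ] D.Htau)) (n : D.Nperp) : ℂ :=
  ∫ w in D.Ω, LinearMap.trace ℂ D.Htau
    (F (sec w) ∘L ContinuousLinearMap.adjoint (D.Xi n (sec w)) : D.Htau →L[ℂ] D.Htau)

/-- `F` is the operator valued function `F_Y` of the finite rank operator `Y` on `H_N`, computed
from some expression `Y = ∑ j, φ j ⊗ conj (ψ j)` and some representatives `φ j`, `ψ j` of elements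
of `H_N`: `F(g) = ∑ j, φ j (g) ⊗ conj (ψ j (g))`. The rank one operator `φ ⊗ conj ψ` is
`χ ↦ ⟪ψ, χ⟫ φ`, with the inner product linear in `χ`. -/
def IsOperatorFunction (Y : D.HN →L[ℂ] D.HN) (F : Heisenberg → (D.Htau →L[ℂ] D.Htau)) : Prop :=
  ∃ (k : ℕ) (φ ψ : Fin k → D.PreHN),
    Y = ∑ j, InnerProductSpace.rankOne ℂ (D.cls (φ j)) (D.cls (ψ j)) ∧
    ∀ g, F g = ∑ j, InnerProductSpace.rankOne ℂ (φ j g) (ψ j g)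

end InducingDatum

end

end WeylBenedicks

open WeylBenedicks

namespace WeylBenedicks

open Heisenberg InnerProductSpace

/-! Write `⟪·,·⟫` for the inner product, linear in the second slot. For X = ∑ a_j ⊗ conj b_j the
trace of X ρ(s(n))^* is ∑ ⟪ρ(s(n)) b_j, a_j⟫. The unitary intertwiner Z turns each term into
⟪ρ_N(s(n)) ψ_j, φ_j⟫ with φ_j = Z a_j and ψ_j = Z b_j, that is, into the integral over Ω of
⟪ψ_j(s(w)s(n)), φ_j(s(w))⟫.

The decisive identity is s(w)s(n) = e(w,n) s(n)s(w), with e(w,n) central (`sec_mul_sec`). For n in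
N^⊥ covariance then converts right translation by s(n) into a pointwise operator: ψ(s(w)s(n)) =
Ξ_n(s(w)) ψ(s(w)) (`apply_sec_mul_sec`). Hence the integrand is the trace of (φ_j(s(w)) ⊗ conj
ψ_j(s(w))) Ξ_n(s(w))^*, and summing over j gives the Fourier–Wigner coefficient
(`coeff_sum_rankOne`).

Independence of the chosen expression needs no separate argument: any expression of X_N pulls back
along Z to an expression of X (`transfer_injective`), and the computation applies to that one. -/

/-! ### Finite rank operators and their traces -/

/-- A continuous operator of finite rank is a finite sum of rank one operators. -/
lemma exists_eq_sum_rankOne {H K : Type*} [NormedAddCommGroup H] [InnerProductSpace ℂ H]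
    [CompleteSpace H] [NormedAddCommGroup K] [InnerProductSpace ℂ K] [CompleteSpace K]
    (X : H →L[ℂ] K) (hX : FiniteDimensional ℂ (LinearMap.range (X : H →ₗ[ℂ] K))) :
    ∃ (k : ℕ) (a : Fin k → K) (b : Fin k → H), X = ∑ j, rankOne ℂ (a j) (b j) := by
  let e := stdOrthonormalBasis ℂ (LinearMap.range (X : H →ₗ[ℂ] K))
  -- Expanding X v in an orthonormal basis e of the range gives coefficients ⟪e_j, X v⟫ = ⟪X^* e_j,
  -- v⟫.
  refine ⟨_, fun j => (e j : K), fun j => ContinuousLinearMap.adjoint X (e j), ?_⟩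
  ext v
  have h := congrArg Subtype.val (e.sum_repr' ⟨X v, v, rfl⟩)
  simp only [AddSubmonoidClass.coe_finsetSum, Submodule.coe_smul, Submodule.coe_inner] at h
  simp only [sum_apply, rankOne_apply,
    ContinuousLinearMap.adjoint_inner_left]
  exact h.symm

/-- The trace of a finite sum of rank one operators. -/
lemma opTrace_sum_rankOne {H : Type*} [NormedAddCommGroup H] [InnerProductSpace ℂ H]
    [CompleteSpace H] {ι : Type*} [Fintype ι] (a b : ι → H) :
    opTrace (∑ j, rankOne ℂ (a j) (b j)) = ∑ j, inner ℂ (b j) (a j) := by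
  -- Parseval's identity holds in every Hilbert basis, so nothing about the chosen one matters.
  set B := (exists_hilbertBasis ℂ H).choose_spec.choose with hB
  have h : HasSum (fun i => ∑ j, inner ℂ (b j) (B i) * inner ℂ (B i) (a j))
      (∑ j, inner ℂ (b j) (a j)) :=
    hasSum_sum fun j _ => B.hasSum_inner_mul_inner (b j) (a j)
  rw [← h.tsum_eq]
  refine tsum_congr fun i => ?_
  simp only [sum_apply, rankOne_apply, inner_sum, inner_smul_right]
  rfl

/-- The Fourier-Wigner transform of a finite sum of rank one operators. -/
lemma fourierWigner_sum_rankOne {ι : Type*} [Fintype ι] (a b : ι → L2R) (w : ℝ × ℝ) :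
    fourierWigner (∑ j, rankOne ℂ (a j) (b j)) w =
      ∑ j, inner ℂ (schrodinger (sec w) (b j)) (a j) := by
  have h : (∑ j, rankOne ℂ (a j) (b j)) ∘L
      ContinuousLinearMap.adjoint (schrodinger (sec w)).toContinuousLinearMap =
      ∑ j, rankOne ℂ (a j) (schrodinger (sec w) (b j)) := by
    ext1 v
    simp only [ContinuousLinearMap.comp_apply, sum_apply, rankOne_apply,
      ContinuousLinearMap.adjoint_inner_right]
    rfl
  rw [fourierWigner, h, opTrace_sum_rankOne]

/-! ### Measurability and integrability of rank one valued functions -/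

lemma continuous_rankOne (E : Type*) [NormedAddCommGroup E] [InnerProductSpace ℂ E] :
    Continuous fun p : E × E => rankOne ℂ p.1 p.2 := by
  have h : ∀ p : E × E, rankOne ℂ p.1 p.2 =
      ContinuousLinearMap.smulRightL ℂ E E (innerSL ℂ p.2) p.1 := fun p => rfl
  simp only [h]
  fun_prop

lemma aestronglyMeasurable_rankOne {α E : Type*} [MeasurableSpace α] {μ : Measure α}
    [NormedAddCommGroup E] [InnerProductSpace ℂ E] {u v : α → E}
    (hu : AEStronglyMeasurable u μ) (hv : AEStronglyMeasurable v μ) :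
    AEStronglyMeasurable (fun w => rankOne ℂ (u w) (v w)) μ := by
  apply (continuous_rankOne E).comp_aestronglyMeasurable (hu.prodMk hv)

lemma integrableOn_finsetSum {α E ι : Type*} [MeasurableSpace α] {μ : Measure α} {S : Set α}
    [NormedAddCommGroup E] (s : Finset ι) (F : ι → α → E)
    (hF : ∀ i ∈ s, IntegrableOn (F i) S μ) : IntegrableOn (fun w => ∑ i ∈ s, F i w) S μ :=
  integrable_finsetSum s hF

/-- The operator norm of u ⊗ conj v is ‖u‖‖v‖, and a product of two square integrable functions is
integrable. -/
lemma integrable_rankOne {α E : Type*} [MeasurableSpace α] {μ : Measure α}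
    [NormedAddCommGroup E] [InnerProductSpace ℂ E] {u v : α → E}
    (hu : MemLp u 2 μ) (hv : MemLp v 2 μ) :
    Integrable (fun w => rankOne ℂ (u w) (v w)) μ := by
  refine (hu.norm.integrable_mul hv.norm).mono (aestronglyMeasurable_rankOne hu.1 hv.1)
    (Filter.Eventually.of_forall fun w => ?_)
  simp [norm_rankOne]

/-! ### Right translation by s(n) as a pointwise operator -/

/-- Lifts to the group of points of the plane commute up to the pairing. -/
lemma sec_mul_sec (w n : ℝ × ℝ) :
    sec w * sec n = ⟨0, 0, pairing w n⟩ * (sec n * sec w) := by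
  ext1
  · simp [sec, add_comm]
  · simp [sec, add_comm]
  · simp only [sec, mul_z, pairing, one_mul, mul_x, mul_y, zero_mul, sub_zero, mul_zero,
      Circle.exp_zero, mul_one]
    -- The two orders of multiplication have central parts exp(±πi(w₁n₂ − w₂n₁)); their quotient has
    -- twice the exponent, which is the pairing.
    rw [← Circle.exp_add]
    congr 1
    ring

namespace InducingDatum

variable (D : InducingDatum)

/-- After the swap, the central factor comes out as the scalar e(w,n) and s(n), lying over N^⊥,
comes out as τ(s(n)); together they are Ξ_n. -/
lemma apply_sec_mul_sec (φ : D.PreHN) (w : ℝ × ℝ) (n : D.Nperp) :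
    φ (sec w * sec n.1) = D.Xi n (sec w) (φ (sec w)) := by
  rw [sec_mul_sec, apply_central_mul, D.PreHN_mul φ ⟨sec n.1, n.2⟩]
  rfl

lemma inner_rhoN_cls (φ ψ : D.PreHN) (n : D.Nperp) :
    inner ℂ (D.rhoN (sec n.1) (D.cls ψ)) (D.cls φ) =
      ∫ w in D.Ω, inner ℂ (D.Xi n (sec w) (ψ (sec w))) (φ (sec w)) := by
  simp only [← D.apply_sec_mul_sec]
  rw [rhoN_cls]
  -- The inner product of classes is that of any representatives, which is why their choice is
  -- immaterial.
  exact SeparationQuotient.inner_mk_mk _ _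

/-- Read backwards, Ξ_n ψ is a translate of ψ and so again square integrable over Ω; no bound on Ξ_n
is needed. -/
lemma integrable_inner_Xi (φ ψ : D.PreHN) (n : D.Nperp) :
    IntegrableOn (fun w => inner ℂ (D.Xi n (sec w) (ψ (sec w))) (φ (sec w))) D.Ω volume := by
  simp only [← D.apply_sec_mul_sec]
  exact D.integrable_inner (D.translate (sec n.1) ψ) φ

/-! ### Covariance and membership in L¹ -/

lemma inner_tau_left (h : preim D.Nperp) (f f' : D.Htau) :
    inner ℂ (D.tau h f) f' = inner ℂ f (D.tau h⁻¹ f') := by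
  rw [← D.inner_tau h f (D.tau h⁻¹ f'), ← mul_apply_eq_comp, ← map_mul,
    mul_inv_cancel, map_one, one_apply_eq_self]

/-- Since τ is unitary, moving τ(h) off the second vector produces τ(h)⁻¹ on the right; this is the
source of the conjugation covariance of F. -/
lemma rankOne_tau (h : preim D.Nperp) (f f' : D.Htau) :
    rankOne ℂ (D.tau h f) (D.tau h f') = D.tau h ∘L rankOne ℂ f f' ∘L D.tau h⁻¹ := by
  ext1 v
  simp only [rankOne_apply, ContinuousLinearMap.comp_apply, map_smul, inner_tau_left]

lemma memL1_rankOne (φ ψ : D.PreHN) : D.MemL1 fun g => rankOne ℂ (φ g) (ψ g) where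
  measurable := aestronglyMeasurable_rankOne (D.PreHN_aesm φ) (D.PreHN_aesm ψ)
  covariant h g := by simp only [D.PreHN_mul, rankOne_tau]
  integrable := integrable_rankOne (D.PreHN_memLp φ) (D.PreHN_memLp ψ)

lemma memL1_sum {ι : Type*} (s : Finset ι) {F : ι → Heisenberg → (D.Htau →L[ℂ] D.Htau)}
    (hF : ∀ i ∈ s, D.MemL1 (F i)) : D.MemL1 fun g => ∑ i ∈ s, F i g where
  measurable := by
    have h := Finset.aestronglyMeasurable_fun_sum s fun i hi => (hF i hi).measurable
    exact h
  covariant h g := by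
    rw [ContinuousLinearMap.finsetSum_comp, ContinuousLinearMap.comp_finsetSum]
    exact Finset.sum_congr rfl fun i hi => (hF i hi).covariant h g
  integrable := by
    have h := integrableOn_finsetSum s (fun i w => F i (sec w)) fun i hi => (hF i hi).integrable
    exact h

/-! ### Fourier–Wigner coefficients as matrix coefficients of ρ_N -/

/-- The adjoint is absorbed into the second vector: (a ⊗ conj b) T^* = a ⊗ conj (T b), whose trace
is ⟪T b, a⟫. -/
lemma trace_sum_rankOne_comp_adjoint {ι : Type*} [Fintype ι] (a b : ι → D.Htau)
    (T : D.Htau →L[ℂ] D.Htau) :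
    LinearMap.trace ℂ D.Htau
      ((∑ j, rankOne ℂ (a j) (b j)) ∘L ContinuousLinearMap.adjoint T : D.Htau →L[ℂ] D.Htau) =
      ∑ j, inner ℂ (T (b j)) (a j) := by
  have h : (∑ j, rankOne ℂ (a j) (b j)) ∘L ContinuousLinearMap.adjoint T =
      ∑ j, rankOne ℂ (a j) (T (b j)) := by
    ext1 v
    simp only [ContinuousLinearMap.comp_apply, sum_apply, rankOne_apply,
      ContinuousLinearMap.adjoint_inner_right]
  rw [h, ContinuousLinearMap.toLinearMap_sum, map_sum]
  exact Finset.sum_congr rfl fun j _ => trace_rankOne _ _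

/-- The pointwise traces are the integrands of the inner products in H_N, each integrable, so sum
and integral may be exchanged. -/
lemma coeff_sum_rankOne {ι : Type*} [Fintype ι] (φ ψ : ι → D.PreHN) (n : D.Nperp) :
    D.coeff (fun g => ∑ j, rankOne ℂ (φ j g) (ψ j g)) n =
      ∑ j, inner ℂ (D.rhoN (sec n.1) (D.cls (ψ j))) (D.cls (φ j)) := by
  simp only [coeff, trace_sum_rankOne_comp_adjoint, inner_rhoN_cls]
  exact integral_finsetSum _ fun j _ => D.integrable_inner_Xi (φ j) (ψ j) n

/-! ### Conjugation by the intertwiner -/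

variable {D}

lemma transfer_sum_rankOne (Z : L2R ≃ₗᵢ[ℂ] D.HN) {ι : Type*} [Fintype ι] (a b : ι → L2R) :
    D.transfer Z (∑ j, rankOne ℂ (a j) (b j)) = ∑ j, rankOne ℂ (Z (a j)) (Z (b j)) := by
  ext1 v
  have h : ∀ u, inner ℂ u (Z.symm v) = inner ℂ (Z u) v := fun u => by
    rw [← Z.inner_map_map, Z.apply_symm_apply]
  change Z ((∑ j, rankOne ℂ (a j) (b j)) (Z.symm v)) = _
  simp only [sum_apply, rankOne_apply, map_sum, map_smul, h]

/-- Lets an expression of X_N be pulled back to one of X. -/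
lemma transfer_injective (Z : L2R ≃ₗᵢ[ℂ] D.HN) : Function.Injective (D.transfer Z) := by
  intro X Y h
  ext1 v
  have h2 : Z (X (Z.symm (Z v))) = Z (Y (Z.symm (Z v))) := congrArg (fun T => T (Z v)) h
  simpa using h2

end InducingDatum

end WeylBenedicks

open WeylBenedicks Heisenberg InducingDatum InnerProductSpace in
theorem theorem2p10 (D : InducingDatum) (Z : L2R ≃ₗᵢ[ℂ] D.HN) (hZ : D.Intertwines Z)
    (X : L2R →L[ℂ] L2R) (hX : FiniteDimensional ℂ (LinearMap.range (X : L2R →ₗ[ℂ] L2R))) :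
    (∃ F : Heisenberg → (D.Htau →L[ℂ] D.Htau), D.IsOperatorFunction (D.transfer Z X) F) ∧
    ∀ F : Heisenberg → (D.Htau →L[ℂ] D.Htau), D.IsOperatorFunction (D.transfer Z X) F →
      D.MemL1 F ∧ ∀ n : D.Nperp, D.coeff F n = fourierWigner X n.1 := by
  constructor
  · obtain ⟨k, a, b, rfl⟩ := exists_eq_sum_rankOne X hX
    -- Elements of H_N are classes, so functions representing Z a_j and Z b_j have to be picked.
    choose φ hφ using fun j => SeparationQuotient.surjective_mk (Z (a j))
    choose ψ hψ using fun j => SeparationQuotient.surjective_mk (Z (b j))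
    refine ⟨_, k, φ, ψ, ?_, fun g => rfl⟩
    simp only [transfer_sum_rankOne, cls, hφ, hψ]
  · rintro F ⟨k, φ, ψ, hY, hF⟩
    obtain rfl : F = fun g => ∑ j, rankOne ℂ (φ j g) (ψ j g) := funext hF
    refine ⟨D.memL1_sum _ fun j _ => D.memL1_rankOne (φ j) (ψ j), fun n => ?_⟩
    -- The given expression of X_N dictates the expression of X, so both sides become sums over the
    -- same index and can be compared term by term.
    obtain rfl : X = ∑ j, rankOne ℂ (Z.symm (D.cls (φ j))) (Z.symm (D.cls (ψ j))) := by
      apply transfer_injective Z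
      simp only [hY, transfer_sum_rankOne, Z.apply_symm_apply]
    rw [coeff_sum_rankOne, fourierWigner_sum_rankOne]
    refine Finset.sum_congr rfl fun j _ => ?_
    -- Unitarity moves the inner product to H_N, and intertwining replaces ρ by ρ_N there.
    rw [← Z.inner_map_map, hZ, Z.apply_symm_apply, Z.apply_symm_apply]
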